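/- Let $X,Y$ be real or complex Hilbert spaces, $\Omega\subseteq X$ open, $F:\Omega\to Y$ analytic such that $F'(x)$ has closed image for every $x\in\Omega$, and let $J:X\to\mathbb R\cup\{+\infty\}$ be proper, convex, and lower semicontinuous at every point of $\Omega$ (if $J$ is only given on $\Omega$, put $J=+\infty$ outside $\Omega$). Let $x_*\in\Omega$, $R>0$ and $$\beta:=\|F'(x_*)^\dagger\|,\qquad \kappa:=\beta\|F'(x_*)\|,\qquad \delta:=\sup\{t\in[0,R): B(x_*,t)\subset\Omega\},$$ where $A^\dagger$ denotes the Moore–Penrose inverse and $B(a,t)$ the open ball. Suppose that $F(x_*)=0$, $0\in\partial J(x_*)$, $F'(x_*)$ is injective, and $$\gamma:=\sup_{n>1}\left(\beta\left\|\frac{F^{(n)}(x_*)}{n!}\right\|\right)^{1/(n-1)}<+\infty .$$ Put $$\bar\rho:=\inf\Big\{s\in(\tfrac{\sqrt2}{2},1): -4s^3+(1-\kappa)s^2+(3+\kappa)s-1<0\Big\},\qquad r:=\min\{(1-\bar\rho)/\gamma,\ \delta\},$$ where $(1-\bar\rho)/\gamma$ is read as $+\infty$ if $\gamma=0$. Write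 $H(x):=F'(x)^*F'(x)$ and $$\mathrm{prox}_J^{H}(z):=\operatorname{argmin}_{y\in X}\big\{J(y)+\tfrac12\langle y-z,H(y-z)\rangle\big\}.$$ Then $\bar\rho>0$, $r>0$, and for every $x_0\in B(x_*,r)\setminus\{x_*\}$ the proximal Gauss–Newton sequence $$x_{k+1}=\mathrm{prox}_J^{H(x_k)}\big(x_k-F'(x_k)^\dagger F(x_k)\big),\qquad k=0,1,\dots,$$ is well defined (for each $k$: $x_k\in\Omega$, $F'(x_k)^\dagger$ exists, $H(x_k)$ is invertible, and the minimizer defining $x_{k+1}$ exists and is unique), is contained in $B(x_*,r)$, converges to $x_*$, and satisfies $$\|x_{k+1}-x_*\|\le\frac{\gamma\,\big[1+(\kappa-1)(1-\gamma\|x_0-x_*\|)^2\big]}{\big[1-2(1-\gamma\|x_0-x_*\|)^2\big]^2}\,\|x_k-x_*\|^2,\qquad k=0,1,\dots$$ -/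

import Mathlib

open Set Filter Topology
open scoped InnerProductSpace

noncomputable section

namespace ProxGaussNewton

variable {𝕜 : Type*} [RCLike 𝕜]
variable {X : Type*} [NormedAddCommGroup X] [InnerProductSpace 𝕜 X] [CompleteSpace X]
variable {Y : Type*} [NormedAddCommGroup Y] [InnerProductSpace 𝕜 Y] [CompleteSpace Y]

/-- The four Penrose equations: `B` is the Moore-Penrose inverse of `A`. -/
structure IsMoorePenroseInverse (A : X →L[𝕜] Y) (B : Y →L[𝕜] X) : Prop where
  mul_mul_left : A ∘L B ∘L A = A
  mul_mul_right : B ∘L A ∘L B = B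
  adjoint_left : ContinuousLinearMap.adjoint (A ∘L B) = A ∘L B
  adjoint_right : ContinuousLinearMap.adjoint (B ∘L A) = B ∘L A

theorem IsMoorePenroseInverse.unique {A : X →L[𝕜] Y} {B C : Y →L[𝕜] X}
    (hB : IsMoorePenroseInverse A B) (hC : IsMoorePenroseInverse A C) : B = C := by
  have h1 : A ∘L B = A ∘L C := by
    have e : (A ∘L C) ∘L (A ∘L B) = A ∘L B := by
      have := congrArg (fun T => T ∘L B) hC.mul_mul_left
      simpa only [ContinuousLinearMap.comp_assoc] using this
    have e' : (A ∘L B) ∘L (A ∘L C) = A ∘L C := by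
      have := congrArg (fun T => T ∘L C) hB.mul_mul_left
      simpa only [ContinuousLinearMap.comp_assoc] using this
    have := congrArg ContinuousLinearMap.adjoint e
    rw [ContinuousLinearMap.adjoint_comp, hB.adjoint_left, hC.adjoint_left, e'] at this
    exact this.symm
  have h2 : B ∘L A = C ∘L A := by
    have e : (B ∘L A) ∘L (C ∘L A) = B ∘L A := by
      have := congrArg (fun T => B ∘L T) hC.mul_mul_left
      simpa only [ContinuousLinearMap.comp_assoc] using this
    have e' : (C ∘L A) ∘L (B ∘L A) = C ∘L A := by
      have := congrArg (fun T => C ∘L T) hB.mul_mul_left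
      simpa only [ContinuousLinearMap.comp_assoc] using this
    have := congrArg ContinuousLinearMap.adjoint e
    rw [ContinuousLinearMap.adjoint_comp, hB.adjoint_right, hC.adjoint_right, e'] at this
    exact this.symm
  calc B = B ∘L (A ∘L B) := hB.mul_mul_right.symm
    _ = (B ∘L A) ∘L C := by rw [h1, ContinuousLinearMap.comp_assoc]
    _ = C ∘L A ∘L C := by rw [h2, ContinuousLinearMap.comp_assoc]
    _ = C := hC.mul_mul_right

open Classical in
/-- The Moore-Penrose inverse `A†` of a bounded operator; it exists exactly when the range of `A`
is closed (and then it is unique), the value is `0` otherwise. -/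
def pinv (A : X →L[𝕜] Y) : Y →L[𝕜] X :=
  if h : ∃ B, IsMoorePenroseInverse A B then h.choose else 0

/-- `J : X → ℝ ∪ {+∞}` is proper. -/
def IsProper (J : X → EReal) : Prop :=
  (∀ x, J x ≠ ⊥) ∧ ∃ x, J x ≠ ⊤

variable (𝕜) in
/-- Convexity of an extended-real-valued function on a real or complex vector space. -/
def IsConvex (J : X → EReal) : Prop :=
  ∀ x y : X, ∀ a b : ℝ, 0 < a → 0 < b → a + b = 1 →
    J ((a : 𝕜) • x + (b : 𝕜) • y) ≤ (a : EReal) * J x + (b : EReal) * J y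

variable (𝕜) in
/-- The subdifferential `∂J(x)` (with the real scalar product `re ⟪·, ·⟫`). -/
def subdifferential (J : X → EReal) (x : X) : Set X :=
  {v | J x ≠ ⊤ ∧ ∀ y, J x + ((RCLike.re ⟪v, y - x⟫_𝕜 : ℝ) : EReal) ≤ J y}

/-- The function `y ↦ J(y) + ½ ‖y - z‖²_H`, where `‖u‖²_H = ⟪u, H u⟫`. -/
def proxObjective (J : X → EReal) (H : X →L[𝕜] X) (z y : X) : EReal :=
  J y + ((1 / 2 * RCLike.re ⟪y - z, H (y - z)⟫_𝕜 : ℝ) : EReal)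

/-- `p` belongs to `argmin_y { J(y) + ½ ‖y - z‖²_H }`. -/
def IsProxPoint (J : X → EReal) (H : X →L[𝕜] X) (z p : X) : Prop :=
  ∀ y, proxObjective J H z p ≤ proxObjective J H z y

open Classical in
/-- The proximity operator `prox_J^H`; the value is `0` where there is no minimizer. -/
def prox (J : X → EReal) (H : X →L[𝕜] X) (z : X) : X :=
  if h : ∃ p, IsProxPoint J H z p then h.choose else 0

variable (𝕜) in
/-- The operator `H(x) = F'(x)* F'(x)`. -/
def normalOp (F : X → Y) (x : X) : X →L[𝕜] X :=
  ContinuousLinearMap.adjoint (fderiv 𝕜 F x) ∘L fderiv 𝕜 F x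

variable (𝕜) in
/-- The Gauss-Newton point `x - F'(x)† F(x)`. -/
def gaussNewtonPoint (F : X → Y) (x : X) : X :=
  x - pinv (fderiv 𝕜 F x) (F x)

variable (𝕜) in
/-- The proximal Gauss-Newton sequence
`x_{k+1} = prox_J^{H(x_k)} (x_k - F'(x_k)† F(x_k))` started at `x₀`. -/
def proxGaussNewtonSeq (F : X → Y) (J : X → EReal) (x₀ : X) : ℕ → X
  | 0 => x₀
  | k + 1 =>
    prox J (normalOp 𝕜 F (proxGaussNewtonSeq F J x₀ k))
      (gaussNewtonPoint 𝕜 F (proxGaussNewtonSeq F J x₀ k))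

variable (𝕜) in
/-- The proximal Gauss-Newton step for `F : Ω → Y` is well defined at `x`: `x` lies in the domain
of `F`, `F'(x)` has a Moore-Penrose inverse, `H(x)` is (boundedly) invertible and the minimization
problem defining the proximity operator has exactly one solution. -/
def StepWellDefined (Ω : Set X) (F : X → Y) (J : X → EReal) (x : X) : Prop :=
  x ∈ Ω ∧ (∃! B, IsMoorePenroseInverse (fderiv 𝕜 F x) B) ∧ IsUnit (normalOp 𝕜 F x) ∧
    ∃! p, IsProxPoint J (normalOp 𝕜 F x) (gaussNewtonPoint 𝕜 F x) p

variable (𝕜) in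
/-- The numbers `(β ‖F⁽ⁿ⁾(x) / n!‖)^{1/(n-1)}`, `n > 1`, whose supremum is Smale's `γ`. -/
def smaleSet (F : X → Y) (x : X) (β : ℝ) : Set ℝ :=
  {a | ∃ n : ℕ, 1 < n ∧
    a = (β * (‖iteratedFDeriv 𝕜 n F x‖ / (n.factorial : ℝ))) ^ (1 / ((n : ℝ) - 1))}

end ProxGaussNewton

end

/-! Write T = F'(x), t = ‖x - x_*‖, s = 1 - γt, d = 2s² - 1. Smale's bound on the Taylor
coefficients at x_* turns two power series into geometric sums: β‖T - F'(x_*)‖ ≤ 1/s² - 1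
(`SmaleBound.norm_fderiv_sub_le`) and β‖T(x - x_*) - F(x)‖ ≤ γt²/s²
(`SmaleBound.norm_linearization_error_le`). Since ‖u‖ ≤ β‖F'(x_*)u‖, the first gives d‖u‖ ≤ s²β‖Tu‖,
so T*T is invertible as soon as d > 0.

The Gauss-Newton point z satisfies T(z - x_*) = TT†(T(x - x_*) - F(x)), and TT† is an orthogonal
projection. As x_* minimizes J, the proximal step does not increase ‖T(· - x_*)‖
(`existsUnique_isProxPoint`). Hence the new point x₊ satisfies d‖x₊ - x_*‖ ≤ γt².

This estimate is free of κ and contracts when γt < d. The polynomial condition defining ρ̄ is the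
stronger requirement γt(1 + (κ-1)s²) < d²; since κ ≥ 1 and 0 < d ≤ 1 it implies γt < d, and the
stated rate follows from γ/d ≤ γ(1 + (κ-1)s²)/d². -/

namespace ProxGaussNewton

/-! ### Taylor series and Smale-type estimates -/

section Taylor

variable {𝕜 : Type*} [RCLike 𝕜]
variable {E : Type*} [NormedAddCommGroup E] [NormedSpace 𝕜 E]
variable {G : Type*} [NormedAddCommGroup G] [NormedSpace 𝕜 G]

variable (𝕜) in
/-- The Taylor series `∑ F⁽ⁿ⁾(x) / n!`. -/
noncomputable def taylorSeries (F : E → G) (x : E) : FormalMultilinearSeries 𝕜 E G :=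
  fun n => ((n.factorial : 𝕜))⁻¹ • iteratedFDeriv 𝕜 n F x

theorem norm_taylorSeries (F : E → G) (x : E) (n : ℕ) :
    ‖taylorSeries 𝕜 F x n‖ = ‖iteratedFDeriv 𝕜 n F x‖ / n.factorial := by
  simp [taylorSeries, norm_smul, div_eq_inv_mul]

/-- Up to isometric currying, the coefficient is a sum over the n-element subsets of `Fin (1 + n)`:
there are n + 1 of them, each contributing at most ‖p (n + 1)‖. -/
theorem norm_derivSeries_le (p : FormalMultilinearSeries 𝕜 E G) (n : ℕ) :
    ‖p.derivSeries n‖ ≤ (n + 1) * ‖p (n + 1)‖ := by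
  have h1 : ‖p.derivSeries n‖ ≤ ‖p.changeOriginSeries 1 n‖ := by
    refine ContinuousMultilinearMap.opNorm_le_bound (ContinuousMultilinearMap.opNorm_nonneg _) fun m => ?_
    have : p.derivSeries n m
        = continuousMultilinearCurryFin1 𝕜 E G (p.changeOriginSeries 1 n m) := rfl
    rw [this, LinearIsometryEquiv.norm_map]
    exact ContinuousMultilinearMap.le_opNorm _ _
  refine h1.trans ?_
  have h2 := p.nnnorm_changeOriginSeries_le_tsum 1 n
  rw [tsum_fintype, Finset.sum_const, Finset.card_univ] at h2
  have hc : Fintype.card { s : Finset (Fin (1 + n)) // s.card = n } = n + 1 := by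
    rw [Fintype.card_finset_len, Fintype.card_fin, add_comm, Nat.choose_succ_self_right]
  rw [hc, nsmul_eq_mul, add_comm 1 n] at h2
  exact_mod_cast h2

/-- Analyticity gives agreement with the Taylor sum only near the centre; the identity principle on
the connected ball extends it to the radius s. -/
theorem hasFPowerSeriesOnBall_taylorSeries [CompleteSpace G] {F : E → G} {x : E} {s : ℝ}
    (hs : 0 < s) (hF : AnalyticOnNhd 𝕜 F (Metric.ball x s))
    (hrad : ENNReal.ofReal s ≤ (taylorSeries 𝕜 F x).radius) :
    HasFPowerSeriesOnBall F (taylorSeries 𝕜 F x) x (ENNReal.ofReal s) := by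
  have hs' : 0 < ENNReal.ofReal s := ENNReal.ofReal_pos.2 hs
  have hsum : HasFPowerSeriesOnBall (fun z => (taylorSeries 𝕜 F x).sum (z - x))
      (taylorSeries 𝕜 F x) x (ENNReal.ofReal s) := by
    simpa using (((taylorSeries 𝕜 F x).hasFPowerSeriesOnBall
      (hs'.trans_le hrad)).mono hs' hrad).comp_sub x
  obtain ⟨q, t, hq⟩ := hF x (Metric.mem_ball_self hs)
  have hev : F =ᶠ[𝓝 x] fun z => (taylorSeries 𝕜 F x).sum (z - x) := by
    filter_upwards [Metric.eball_mem_nhds x hq.r_pos] with z hz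
    have hz' : z - x ∈ Metric.eball (0 : E) t := by
      simpa [edist_eq_enorm_sub] using hz
    have := (hq.hasSum_iteratedFDeriv hz').tsum_eq
    rw [add_sub_cancel] at this
    rw [← this]
    rfl
  have hball : Metric.eball x (ENNReal.ofReal s) = Metric.ball x s := Metric.eball_ofReal
  refine hsum.congr ?_
  rw [hball]
  have hpre : IsPreconnected (Metric.ball x s) := by
    let : NormedSpace ℝ E := NormedSpace.restrictScalars ℝ 𝕜 E
    exact (convex_ball x s).isPreconnected
  have han := hsum.analyticOnNhd
  rw [hball] at han
  exact (hF.eqOn_of_preconnected_of_eventuallyEq han hpre (Metric.mem_ball_self hs) hev).symm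

/-- The sum `∑_{n ≥ 1} (n + 1) qⁿ = 1 / (1 - q)² - 1`. -/
theorem hasSum_succ_mul_geometric_tail {q : ℝ} (h0 : 0 ≤ q) (h1 : q < 1) :
    HasSum (fun n : ℕ => ((n : ℝ) + 2) * q ^ (n + 1)) (1 / (1 - q) ^ 2 - 1) := by
  have h := hasSum_choose_mul_geometric_of_norm_lt_one 1
    (by rwa [Real.norm_of_nonneg h0] : ‖q‖ < 1)
  rw [← hasSum_nat_add_iff' 1] at h
  convert! h using 1
  · ext n
    simp only [Nat.choose_one_right]
    push_cast
    ring
  · simp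

section Smale

variable {F : E → G} {x : E} {s β γ : ℝ}

/-- The Taylor coefficients satisfy Smale's bound `β ‖F⁽ⁿ⁾(x) / n!‖ ≤ γⁿ⁻¹`. -/
def SmaleBound (p : FormalMultilinearSeries 𝕜 E G) (β γ : ℝ) : Prop :=
  ∀ n : ℕ, β * ‖p (n + 2)‖ ≤ γ ^ (n + 1)

theorem SmaleBound.le_radius {p : FormalMultilinearSeries 𝕜 E G} (hp : SmaleBound p β γ)
    (hβ : 0 < β) (hγ : 0 ≤ γ) (hs : 0 < s) (hγs : γ * s < 1) : ENNReal.ofReal s ≤ p.radius := by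
  refine p.le_radius_of_eventually_le (s / β) ?_
  filter_upwards [eventually_ge_atTop 2] with n hn
  obtain ⟨m, rfl⟩ := Nat.exists_eq_add_of_le' hn
  rw [Real.coe_toNNReal s hs.le, le_div_iff₀ hβ]
  calc ‖p (m + 2)‖ * s ^ (m + 2) * β = β * ‖p (m + 2)‖ * s ^ (m + 2) := by ring
    _ ≤ γ ^ (m + 1) * s ^ (m + 2) := by gcongr; exact hp m
    _ = (γ * s) ^ (m + 1) * s := by ring
    _ ≤ 1 * s := by gcongr; exact pow_le_one₀ (by positivity) hγs.le
    _ = s := one_mul s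

variable [CompleteSpace G]

theorem SmaleBound.hasFPowerSeriesOnBall (hp : SmaleBound (taylorSeries 𝕜 F x) β γ)
    (hβ : 0 < β) (hγ : 0 ≤ γ) (hs : 0 < s) (hγs : γ * s < 1)
    (hF : AnalyticOnNhd 𝕜 F (Metric.ball x s)) :
    HasFPowerSeriesOnBall F (taylorSeries 𝕜 F x) x (ENNReal.ofReal s) :=
  hasFPowerSeriesOnBall_taylorSeries hs hF (hp.le_radius hβ hγ hs hγs)

variable {p : FormalMultilinearSeries 𝕜 E G}

/-- Differentiate termwise: the constant term is F'(x), and what remains is dominated by ∑ (n +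
1)(γ‖h‖)ⁿ over n ≥ 1. -/
theorem SmaleBound.norm_fderiv_sub_le (hp : SmaleBound p β γ)
    (hβ : 0 < β) (hγ : 0 ≤ γ) (hγs : γ * s < 1)
    (hF : HasFPowerSeriesOnBall F p x (ENNReal.ofReal s)) {h : E} (hh : ‖h‖ < s) :
    β * ‖fderiv 𝕜 F (x + h) - fderiv 𝕜 F x‖ ≤ 1 / (1 - γ * ‖h‖) ^ 2 - 1 := by
  have hq : γ * ‖h‖ < 1 := (mul_le_mul_of_nonneg_left hh.le hγ).trans_lt hγs
  have hmem : h ∈ Metric.eball (0 : E) (ENNReal.ofReal s) := by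
    rw [Metric.eball_ofReal]; simpa using hh
  have hsum := hF.fderiv.hasSum hmem
  rw [← hasSum_nat_add_iff' 1] at hsum
  have h0 : p.derivSeries 0 (fun _ => h) = fderiv 𝕜 F x := hF.fderiv.coeff_zero _
  rw [Finset.sum_range_one, h0] at hsum
  rw [mul_comm, ← le_div_iff₀ hβ, ← hsum.tsum_eq]
  refine tsum_of_norm_bounded
    ((hasSum_succ_mul_geometric_tail (by positivity) hq).div_const β) fun n => ?_
  rw [le_div_iff₀ hβ]
  calc ‖p.derivSeries (n + 1) fun _ => h‖ * β
      ≤ ‖p.derivSeries (n + 1)‖ * ‖h‖ ^ (n + 1) * β := by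
        gcongr
        simpa using (p.derivSeries (n + 1)).le_opNorm (fun _ => h)
    _ ≤ (((n + 1 : ℕ) : ℝ) + 1) * ‖p (n + 2)‖ * ‖h‖ ^ (n + 1) * β := by
        gcongr
        exact norm_derivSeries_le p (n + 1)
    _ = ((n : ℝ) + 2) * (β * ‖p (n + 2)‖) * ‖h‖ ^ (n + 1) := by push_cast; ring
    _ ≤ ((n : ℝ) + 2) * γ ^ (n + 1) * ‖h‖ ^ (n + 1) := by gcongr; exact hp n
    _ = ((n : ℝ) + 2) * (γ * ‖h‖) ^ (n + 1) := by ring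

theorem SmaleBound.norm_linearization_error_le (hp : SmaleBound p β γ)
    (hβ : 0 < β) (hγ : 0 ≤ γ) (hγs : γ * s < 1)
    (hF : HasFPowerSeriesOnBall F p x (ENNReal.ofReal s)) (hFx : F x = 0) {h : E} (hh : ‖h‖ < s) :
    β * ‖fderiv 𝕜 F (x + h) h - F (x + h)‖ ≤ γ * ‖h‖ ^ 2 / (1 - γ * ‖h‖) ^ 2 := by
  have hq : γ * ‖h‖ < 1 := (mul_le_mul_of_nonneg_left hh.le hγ).trans_lt hγs
  have hmem : h ∈ Metric.eball (0 : E) (ENNReal.ofReal s) := by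
    rw [Metric.eball_ofReal]; simpa using hh
  -- Subtracting the series of F(x + h), whose constant term F(x) vanishes, leaves ∑ n p_{n+1}(h, …,
  -- h). The term n = 0 drops out, so only coefficients covered by Smale's bound remain.
  have hd : HasSum (fun n => (n + 1) • p (n + 1) fun _ => h) (fderiv 𝕜 F (x + h) h) := by
    have := (ContinuousLinearMap.apply 𝕜 G h).hasSum (hF.fderiv.hasSum hmem)
    simpa [Function.comp_def, FormalMultilinearSeries.derivSeries_apply_diag] using this
  have hf := hF.hasSum hmem
  rw [← hasSum_nat_add_iff' 1, Finset.sum_range_one, hF.coeff_zero, hFx, sub_zero] at hf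
  have hsum := hd.sub hf
  rw [mul_comm, ← le_div_iff₀ hβ, ← hsum.tsum_eq]
  have hg := ((hasSum_coe_mul_geometric_of_norm_lt_one
    (by rwa [Real.norm_of_nonneg (by positivity)] : ‖γ * ‖h‖‖ < 1)).mul_left ‖h‖).div_const β
  have e : ‖h‖ * (γ * ‖h‖ / (1 - γ * ‖h‖) ^ 2) = γ * ‖h‖ ^ 2 / (1 - γ * ‖h‖) ^ 2 := by ring
  rw [e] at hg
  refine tsum_of_norm_bounded hg fun n => ?_
  rw [le_div_iff₀ hβ, add_smul, one_smul, add_sub_cancel_right]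
  rcases n with _ | n
  · simp
  calc ‖(n + 1) • p (n + 1 + 1) fun _ => h‖ * β
      ≤ ((n + 1 : ℕ) : ℝ) * (‖p (n + 2)‖ * ‖h‖ ^ (n + 2)) * β := by
        gcongr
        refine (norm_nsmul_le).trans ?_
        gcongr
        simpa using (p (n + 2)).le_opNorm (fun _ => h)
    _ = ((n + 1 : ℕ) : ℝ) * (β * ‖p (n + 2)‖) * ‖h‖ ^ (n + 2) := by ring
    _ ≤ ((n + 1 : ℕ) : ℝ) * γ ^ (n + 1) * ‖h‖ ^ (n + 2) := by gcongr; exact hp n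
    _ = ‖h‖ * (((n + 1 : ℕ) : ℝ) * (γ * ‖h‖) ^ (n + 1)) := by ring

end Smale

end Taylor

/-! ### Operators bounded below and Moore-Penrose inverses -/

section Operators

variable {𝕜 : Type*} [RCLike 𝕜]
variable {X : Type*} [NormedAddCommGroup X] [InnerProductSpace 𝕜 X] [CompleteSpace X]
variable {Y : Type*} [NormedAddCommGroup Y] [InnerProductSpace 𝕜 Y] [CompleteSpace Y]

theorem re_inner_adjoint_comp_self (T : X →L[𝕜] Y) (u : X) :
    RCLike.re ⟪u, (ContinuousLinearMap.adjoint T ∘L T) u⟫_𝕜 = ‖T u‖ ^ 2 := by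
  rw [ContinuousLinearMap.comp_apply, ContinuousLinearMap.adjoint_inner_right,
    inner_self_eq_norm_sq]

theorem isUnit_adjoint_comp_self {T : X →L[𝕜] Y} {c : ℝ} (hc : 0 < c)
    (hT : ∀ u, c * ‖u‖ ≤ ‖T u‖) : IsUnit (ContinuousLinearMap.adjoint T ∘L T) := by
  refine ContinuousLinearMap.isUnit_of_forall_le_norm_inner_map _
    (c := ⟨c ^ 2, sq_nonneg c⟩) (by exact_mod_cast pow_pos hc 2) fun u => ?_
  have h := RCLike.norm_re_le_norm ⟪u, (ContinuousLinearMap.adjoint T ∘L T) u⟫_𝕜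
  rw [re_inner_adjoint_comp_self, Real.norm_of_nonneg (sq_nonneg _), norm_inner_symm] at h
  refine le_trans ?_ h
  have := pow_le_pow_left₀ (by positivity) (hT u) 2
  rw [mul_pow] at this
  rw [mul_comm]
  exact this

/-- The inverse is (T*T)⁻¹T*, which is a left inverse of T; only the self-adjointness of T(T*T)⁻¹T*
needs that of (T*T)⁻¹. -/
theorem exists_isMoorePenroseInverse {T : X →L[𝕜] Y}
    (hT : IsUnit (ContinuousLinearMap.adjoint T ∘L T)) : ∃ B, IsMoorePenroseInverse T B := by
  obtain ⟨U, hU⟩ := hT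
  set H : X →L[𝕜] X := ContinuousLinearMap.adjoint T ∘L T with hH
  set K : X →L[𝕜] X := ↑U⁻¹ with hK
  have hKH : K ∘L H = ContinuousLinearMap.id 𝕜 X := by
    rw [← hU]; exact U.inv_mul
  have hHK : H ∘L K = ContinuousLinearMap.id 𝕜 X := by
    rw [← hU]; exact U.mul_inv
  have hHs : ContinuousLinearMap.adjoint H = H := by
    rw [hH, ContinuousLinearMap.adjoint_comp, ContinuousLinearMap.adjoint_adjoint]
  have hKs : ContinuousLinearMap.adjoint K = K := by
    have h1 : ContinuousLinearMap.adjoint K ∘L H = ContinuousLinearMap.id 𝕜 X := by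
      have := congrArg ContinuousLinearMap.adjoint hHK
      rwa [ContinuousLinearMap.adjoint_comp, hHs, ContinuousLinearMap.adjoint_id] at this
    calc ContinuousLinearMap.adjoint K
        = ContinuousLinearMap.adjoint K ∘L (H ∘L K) := by rw [hHK, ContinuousLinearMap.comp_id]
      _ = K := by rw [← ContinuousLinearMap.comp_assoc, h1, ContinuousLinearMap.id_comp]
  have hBT : (K ∘L ContinuousLinearMap.adjoint T) ∘L T = ContinuousLinearMap.id 𝕜 X := by
    rw [ContinuousLinearMap.comp_assoc, ← hH, hKH]
  refine ⟨K ∘L ContinuousLinearMap.adjoint T, ?_, ?_, ?_, ?_⟩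
  · rw [hBT, ContinuousLinearMap.comp_id]
  · rw [← ContinuousLinearMap.comp_assoc, hBT, ContinuousLinearMap.id_comp]
  · rw [ContinuousLinearMap.adjoint_comp, ContinuousLinearMap.adjoint_comp, hKs,
      ContinuousLinearMap.adjoint_adjoint, ContinuousLinearMap.comp_assoc]
  · rw [hBT, ContinuousLinearMap.adjoint_id]

theorem pinv_spec {T : X →L[𝕜] Y} (h : ∃ B, IsMoorePenroseInverse T B) :
    IsMoorePenroseInverse T (pinv T) := by
  rw [pinv, dif_pos h]
  exact h.choose_spec

theorem IsMoorePenroseInverse.apply_apply_of_injective {T : X →L[𝕜] Y} {B : Y →L[𝕜] X}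
    (h : IsMoorePenroseInverse T B) (hT : Function.Injective T) (u : X) : B (T u) = u :=
  hT (DFunLike.congr_fun h.mul_mul_left u)

/-- TB is self-adjoint and idempotent, that is, an orthogonal projection. -/
theorem IsMoorePenroseInverse.norm_apply_apply_le {T : X →L[𝕜] Y} {B : Y →L[𝕜] X}
    (h : IsMoorePenroseInverse T B) (v : Y) : ‖T (B v)‖ ≤ ‖v‖ := by
  have h1 : ‖T (B v)‖ ^ 2 ≤ ‖v‖ * ‖T (B v)‖ := by
    calc ‖T (B v)‖ ^ 2 = RCLike.re ⟪T (B v), T (B v)⟫_𝕜 := (inner_self_eq_norm_sq _).symm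
      _ = RCLike.re ⟪v, ContinuousLinearMap.adjoint (T ∘L B) (T (B v))⟫_𝕜 := by
          rw [ContinuousLinearMap.adjoint_inner_right]; rfl
      _ = RCLike.re ⟪v, T (B v)⟫_𝕜 := by
          rw [h.adjoint_left]
          congr 2
          exact DFunLike.congr_fun h.mul_mul_left (B v)
      _ ≤ ‖v‖ * ‖T (B v)‖ := re_inner_le_norm _ _
  by_contra! hlt
  have : 0 < ‖T (B v)‖ := (norm_nonneg v).trans_lt hlt
  nlinarith

/-- `‖T (T† w - u)‖ ≤ ‖w - T u‖`. -/
theorem norm_map_pinv_sub_le {T : X →L[𝕜] Y} (h : ∃ B, IsMoorePenroseInverse T B)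
    (w : Y) (u : X) : ‖T (u - pinv T w)‖ ≤ ‖T u - w‖ := by
  have hB := pinv_spec h
  have e : T (u - pinv T w) = T (pinv T (T u - w)) := by
    have : T (pinv T (T u)) = T u := DFunLike.congr_fun hB.mul_mul_left u
    rw [map_sub, map_sub, map_sub, this]
  rw [e]
  exact hB.norm_apply_apply_le _

theorem exists_isMoorePenroseInverse_of_isClosed_range {T : X →L[𝕜] Y}
    (hinj : Function.Injective T) (hcl : IsClosed (Set.range T)) :
    ∃ B, IsMoorePenroseInverse T B := by
  obtain ⟨K, hK⟩ := T.antilipschitz_of_injective_of_isClosed_range hinj hcl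
  refine exists_isMoorePenroseInverse (isUnit_adjoint_comp_self (c := 1 / ((K : ℝ) + 1))
    (by positivity) fun u => ?_)
  have h := hK.le_mul_dist u 0
  rw [dist_zero_right, map_zero, dist_zero_right] at h
  rw [one_div, inv_mul_le_iff₀ (by positivity)]
  nlinarith [norm_nonneg (T u)]

end Operators

/-! ### The proximity operator in the metric of T*T -/

section Prox

variable {𝕜 : Type*} [RCLike 𝕜]
variable {X : Type*} [NormedAddCommGroup X] [InnerProductSpace 𝕜 X]
variable {Y : Type*} [NormedAddCommGroup Y] [InnerProductSpace 𝕜 Y]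

variable (𝕜) in
theorem norm_sq_convex_combination {a b : ℝ} (hab : a + b = 1) (u v : Y) :
    ‖(a : 𝕜) • u + (b : 𝕜) • v‖ ^ 2
      = a * ‖u‖ ^ 2 + b * ‖v‖ ^ 2 - a * b * ‖u - v‖ ^ 2 := by
  have hb : b = 1 - a := by linarith
  rw [@norm_add_sq 𝕜, @norm_sub_sq 𝕜, inner_smul_left, inner_smul_right, RCLike.conj_ofReal,
    RCLike.re_ofReal_mul, RCLike.re_ofReal_mul, norm_smul, norm_smul, mul_pow, mul_pow,
    RCLike.norm_ofReal, RCLike.norm_ofReal, sq_abs, sq_abs, hb]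
  ring

/-- The real-valued objective `J(y) + ½ ‖T (y - z)‖²` on the domain of `J`. -/
noncomputable def realObjective (J : X → EReal) (T : X →L[𝕜] Y) (z y : X) : ℝ :=
  (J y).toReal + 1 / 2 * ‖T (y - z)‖ ^ 2

theorem proxObjective_eq_coe [CompleteSpace X] [CompleteSpace Y] {J : X → EReal} (hJp : IsProper J)
    (T : X →L[𝕜] Y) (z : X) {y : X} (hy : J y ≠ ⊤) :
    proxObjective J (ContinuousLinearMap.adjoint T ∘L T) z y = (realObjective J T z y : EReal) := by
  rw [proxObjective, re_inner_adjoint_comp_self, realObjective, EReal.coe_add,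
    EReal.coe_toReal hy (hJp.1 y)]

theorem isProxPoint_iff [CompleteSpace X] [CompleteSpace Y] {J : X → EReal} (hJp : IsProper J)
    (T : X →L[𝕜] Y) (z p : X) :
    IsProxPoint J (ContinuousLinearMap.adjoint T ∘L T) z p ↔
      J p ≠ ⊤ ∧ ∀ y, J y ≠ ⊤ → realObjective J T z p ≤ realObjective J T z y := by
  constructor
  · intro h
    obtain ⟨w, hw⟩ := hJp.2
    have hp : J p ≠ ⊤ := by
      intro hp
      have := h w
      rw [proxObjective_eq_coe hJp T z hw, proxObjective, hp, EReal.top_add_coe] at this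
      exact EReal.coe_ne_top _ (top_le_iff.1 this)
    refine ⟨hp, fun y hy => ?_⟩
    have := h y
    rw [proxObjective_eq_coe hJp T z hy, proxObjective_eq_coe hJp T z hp] at this
    exact_mod_cast this
  · rintro ⟨hp, h⟩ y
    by_cases hy : J y = ⊤
    · rw [proxObjective.eq_def J _ z y, hy, EReal.top_add_coe]
      exact le_top
    · rw [proxObjective_eq_coe hJp T z hy, proxObjective_eq_coe hJp T z hp]
      exact_mod_cast h y hy

/-- The quadratic term makes the objective strongly convex for the seminorm ‖T ·‖; existence,
uniqueness and nonexpansiveness all come from this gain. -/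
theorem IsConvex.realObjective_le {J : X → EReal} (hJp : IsProper J) (hJc : IsConvex 𝕜 J)
    (T : X →L[𝕜] Y) (z : X) {y w : X} (hy : J y ≠ ⊤) (hw : J w ≠ ⊤) {a b : ℝ}
    (ha : 0 < a) (hb : 0 < b) (hab : a + b = 1) :
    J ((a : 𝕜) • y + (b : 𝕜) • w) ≠ ⊤ ∧
      realObjective J T z ((a : 𝕜) • y + (b : 𝕜) • w) ≤
        a * realObjective J T z y + b * realObjective J T z w
          - 1 / 2 * (a * b) * ‖T (y - w)‖ ^ 2 := by
  have h := hJc y w a b ha hb hab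
  rw [← EReal.coe_toReal hy (hJp.1 y), ← EReal.coe_toReal hw (hJp.1 w), ← EReal.coe_mul,
    ← EReal.coe_mul, ← EReal.coe_add] at h
  have hne : J ((a : 𝕜) • y + (b : 𝕜) • w) ≠ ⊤ := (h.trans_lt (EReal.coe_lt_top _)).ne
  refine ⟨hne, ?_⟩
  rw [← EReal.coe_toReal hne (hJp.1 _), EReal.coe_le_coe_iff] at h
  have e : T ((a : 𝕜) • y + (b : 𝕜) • w - z) = (a : 𝕜) • T (y - z) + (b : 𝕜) • T (w - z) := by
    rw [← map_smul, ← map_smul, ← map_add]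
    congr 1
    have hz : z = (a : 𝕜) • z + (b : 𝕜) • z := by
      rw [← add_smul, ← RCLike.ofReal_add, hab, RCLike.ofReal_one, one_smul]
    rw [smul_sub, smul_sub]
    nth_rewrite 1 [hz]
    abel
  have e' : T (y - z) - T (w - z) = T (y - w) := by
    rw [← map_sub]; congr 1; abel
  have hn := norm_sq_convex_combination 𝕜 hab (T (y - z)) (T (w - z))
  rw [e'] at hn
  rw [realObjective, e, hn, realObjective, realObjective]
  linarith

/-- Existence, uniqueness and nonexpansiveness at a minimizer of `J` of the proximity operator in
the metric of `T* T`.  Lower semicontinuity of `J` is needed only on an open set which contains the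
points that the nonexpansiveness leaves possible. -/
theorem existsUnique_isProxPoint [CompleteSpace X] [CompleteSpace Y] {Ω : Set X} (hΩ : IsOpen Ω) {J : X → EReal}
    (hJp : IsProper J) (hJc : IsConvex 𝕜 J) (hJl : LowerSemicontinuousOn J Ω)
    {xs : X} (hfin : J xs ≠ ⊤) (hmin : ∀ y, J xs ≤ J y)
    {T : X →L[𝕜] Y} {c : ℝ} (hc : 0 < c) (hT : ∀ u, c * ‖u‖ ≤ ‖T u‖) {z : X}
    (hsub : ∀ p, ‖T (p - xs)‖ ≤ ‖T (z - xs)‖ → p ∈ Ω) :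
    ∃ p, IsProxPoint J (ContinuousLinearMap.adjoint T ∘L T) z p ∧
      (∀ q, IsProxPoint J (ContinuousLinearMap.adjoint T ∘L T) z q → q = p) ∧
      ‖T (p - xs)‖ ≤ ‖T (z - xs)‖ := by
  set φ := realObjective J T z with hφ
  have hJ0 : ∀ y, J y ≠ ⊤ → (J xs).toReal ≤ (J y).toReal := fun y hy =>
    EReal.toReal_le_toReal (hmin y) (hJp.1 xs) hy
  have hφ0 : ∀ y, J y ≠ ⊤ → (J xs).toReal ≤ φ y := fun y hy =>
    (hJ0 y hy).trans (le_add_of_nonneg_right (by positivity))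
  set S : Set ℝ := φ '' {y | J y ≠ ⊤}
  set m := sInf S
  have hSne : S.Nonempty := ⟨φ xs, xs, hfin, rfl⟩
  have hSbdd : BddBelow S := ⟨(J xs).toReal, by rintro _ ⟨y, hy, rfl⟩; exact hφ0 y hy⟩
  have hmle : ∀ y, J y ≠ ⊤ → m ≤ φ y := fun y hy => csInf_le hSbdd ⟨y, hy, rfl⟩
  have hm0 : (J xs).toReal ≤ m :=
    le_csInf hSne (by rintro _ ⟨y, hy, rfl⟩; exact hφ0 y hy)
  have hconv : ∀ y w, J y ≠ ⊤ → J w ≠ ⊤ → ∀ a b : ℝ, 0 < a → 0 < b → a + b = 1 →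
      m ≤ a * φ y + b * φ w - 1 / 2 * (a * b) * ‖T (y - w)‖ ^ 2 := by
    intro y w hy hw a b ha hb hab
    obtain ⟨h1, h2⟩ := hJc.realObjective_le hJp T z hy hw ha hb hab
    exact (hmle _ h1).trans h2
  have hseq : ∀ n : ℕ, ∃ y, J y ≠ ⊤ ∧ φ y < m + 1 / ((n : ℝ) + 1) := by
    intro n
    obtain ⟨_, ⟨y, hy, rfl⟩, h⟩ := exists_lt_of_csInf_lt hSne
      (lt_add_of_pos_right m (Nat.one_div_pos_of_nat (α := ℝ) (n := n)))
    exact ⟨y, hy, h⟩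
  choose y hyfin hylt using hseq
  have hφy : Tendsto (fun n => φ (y n)) atTop (𝓝 m) := by
    refine tendsto_of_tendsto_of_tendsto_of_le_of_le tendsto_const_nhds
      (by simpa using (tendsto_one_div_add_atTop_nhds_zero_nat (𝕜 := ℝ)).const_add m) (fun n => hmle _ (hyfin n))
      (fun n => (hylt n).le)
  -- Strong convexity at the midpoint has gain ⅛‖T(yₙ - yₖ)‖², whence the factor 8.
  have hcauchy : CauchySeq y := by
    refine cauchySeq_of_le_tendsto_0 (fun N : ℕ => Real.sqrt (8 * (1 / ((N : ℝ) + 1))) / c)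
      (fun n k N hn hk => ?_) ?_
    · have hle : ∀ i, N ≤ i → φ (y i) ≤ m + 1 / ((N : ℝ) + 1) := fun i hi =>
        (hylt i).le.trans (by gcongr)
      have h := hconv (y n) (y k) (hyfin n) (hyfin k) (1 / 2) (1 / 2) (by norm_num) (by norm_num)
        (by norm_num)
      have h1 := hle n hn
      have h2 := hle k hk
      rw [le_div_iff₀ hc, dist_eq_norm, mul_comm]
      refine (hT _).trans (Real.le_sqrt_of_sq_le ?_)
      linarith
    · have h0 := (tendsto_one_div_add_atTop_nhds_zero_nat (𝕜 := ℝ)).const_mul 8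
      have := ((Real.continuous_sqrt.tendsto _).comp h0).div_const c
      simpa using this
  obtain ⟨p, hp⟩ := cauchySeq_tendsto_of_complete hcauchy
  have hTp : ∀ w, Tendsto (fun n => ‖T (y n - w)‖ ^ 2) atTop (𝓝 (‖T (p - w)‖ ^ 2)) := fun w =>
    ((T.continuous.tendsto _).comp (hp.sub_const w)).norm.pow 2
  -- The limit must be located in Ω before semicontinuity can be used. Comparing yₙ with x_* along a
  -- segment of weight a and letting n → ∞ gives ½a‖T(p - x_*)‖² ≤ φ(x_*) - m, where m ≥ J(x_*);
  -- then a → 1.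
  have hpxs : ‖T (p - xs)‖ ≤ ‖T (z - xs)‖ := by
    have key : ∀ a : ℝ, 0 < a → a < 1 → a * ‖T (p - xs)‖ ^ 2 ≤ ‖T (z - xs)‖ ^ 2 := by
      intro a ha ha1
      have hlim : Tendsto (fun n => a * φ (y n) + (1 - a) * φ xs
          - 1 / 2 * (a * (1 - a)) * ‖T (y n - xs)‖ ^ 2) atTop
          (𝓝 (a * m + (1 - a) * φ xs - 1 / 2 * (a * (1 - a)) * ‖T (p - xs)‖ ^ 2)) :=
        ((hφy.const_mul a).add_const _).sub ((hTp xs).const_mul _)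
      have h := ge_of_tendsto' hlim fun n =>
        hconv (y n) xs (hyfin n) hfin a (1 - a) ha (by linarith) (by ring)
      have hxs : φ xs = (J xs).toReal + 1 / 2 * ‖T (z - xs)‖ ^ 2 := by
        rw [hφ, realObjective, ← neg_sub z xs, map_neg, norm_neg]
      have h' : 0 ≤ (1 - a) * (φ xs - m - 1 / 2 * a * ‖T (p - xs)‖ ^ 2) := by linarith
      have h'' := nonneg_of_mul_nonneg_right h' (by linarith)
      linarith
    refine le_of_sq_le_sq ?_ (norm_nonneg _)
    have hlim : Tendsto (fun a : ℝ => a * ‖T (p - xs)‖ ^ 2) (𝓝[<] 1) (𝓝 (1 * ‖T (p - xs)‖ ^ 2)) :=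
      (tendsto_id.mul_const _).mono_left nhdsWithin_le_nhds
    rw [one_mul] at hlim
    refine le_of_tendsto hlim ?_
    filter_upwards [Ioo_mem_nhdsLT (zero_lt_one (α := ℝ))] with a ha using key a ha.1 ha.2
  have hpΩ : p ∈ Ω := hsub p hpxs
  -- J(yₙ) = φ(yₙ) - ½‖T(yₙ - z)‖² converges to the right-hand side, so lower semicontinuity at p ∈
  -- Ω gives the bound.
  have hJp_le : J p ≤ ((m - 1 / 2 * ‖T (p - z)‖ ^ 2 : ℝ) : EReal) := by
    by_contra! hlt
    obtain ⟨v, hv1, hv2⟩ := EReal.lt_iff_exists_real_btwn.1 hlt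
    have hev := hJl p hpΩ v hv2
    rw [hΩ.nhdsWithin_eq hpΩ] at hev
    have hle : v ≤ m - 1 / 2 * ‖T (p - z)‖ ^ 2 := by
      refine ge_of_tendsto (hφy.sub ((hTp z).const_mul (1 / 2))) ?_
      filter_upwards [hp.eventually hev] with n hn
      rw [← EReal.coe_toReal (hyfin n) (hJp.1 _), gt_iff_lt, EReal.coe_lt_coe_iff] at hn
      rw [hφ, realObjective]
      linarith
    exact absurd (EReal.coe_lt_coe_iff.1 hv1) (not_lt.2 hle)
  have hpfin : J p ≠ ⊤ := (hJp_le.trans_lt (EReal.coe_lt_top _)).ne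
  have hφp : φ p ≤ m := by
    rw [← EReal.coe_toReal hpfin (hJp.1 _), EReal.coe_le_coe_iff] at hJp_le
    rw [hφ, realObjective]
    linarith
  refine ⟨p, (isProxPoint_iff hJp T z p).2 ⟨hpfin, fun w hw => hφp.trans (hmle w hw)⟩,
    fun q hq => ?_, hpxs⟩
  obtain ⟨hqfin, hq⟩ := (isProxPoint_iff hJp T z q).1 hq
  have h := hconv q p hqfin hpfin (1 / 2) (1 / 2) (by norm_num) (by norm_num) (by norm_num)
  have h1 := hq p hpfin
  have h2 : ‖T (q - p)‖ ^ 2 ≤ 0 := by linarith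
  have h3 : ‖T (q - p)‖ = 0 := pow_eq_zero_iff two_ne_zero |>.1 (le_antisymm h2 (sq_nonneg _))
  have h4 := hT (q - p)
  rw [h3] at h4
  have h5 : ‖q - p‖ = 0 := le_antisymm (nonpos_of_mul_nonpos_right h4 hc) (norm_nonneg _)
  exact sub_eq_zero.1 (norm_eq_zero.1 h5)

end Prox

/-! ### The polynomial defining the radius of convergence -/

section RadiusPolynomial

/-- The polynomial whose sign governs the radius of convergence. -/
def radiusPoly (κ s : ℝ) : ℝ := -4 * s ^ 3 + (1 - κ) * s ^ 2 + (3 + κ) * s - 1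

/-- For s = 1 - γt with 2s² > 1, negativity says exactly that the claimed rate constant times t is
less than 1. -/
theorem mul_radiusPoly (κ s : ℝ) :
    s * radiusPoly κ s = (1 - s) * (1 + (κ - 1) * s ^ 2) - (2 * s ^ 2 - 1) ^ 2 := by
  rw [radiusPoly]; ring

theorem half_lt_sqrt_two_div_two : 1 / 2 < Real.sqrt 2 / 2 := by
  have : (1 : ℝ) < Real.sqrt 2 := Real.lt_sqrt_of_sq_lt (by norm_num)
  linarith

theorem sq_sqrt_two_div_two : (Real.sqrt 2 / 2) ^ 2 = 1 / 2 := by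
  rw [div_pow, Real.sq_sqrt (by norm_num)]; norm_num

/-- The polynomial is concave to the right of √2/2 and nonnegative there at the endpoint, so once
negative it stays negative. Thus every s in (ρ̄, 1), not merely points near the infimum, is
admissible. -/
theorem radiusPoly_neg_of_lt {κ s₁ s : ℝ} (hκ : 0 ≤ κ) (h₁ : Real.sqrt 2 / 2 < s₁) (h : s₁ < s)
    (hneg : radiusPoly κ s₁ < 0) : radiusPoly κ s < 0 := by
  have ha := half_lt_sqrt_two_div_two
  have ha2 := sq_sqrt_two_div_two
  set a := Real.sqrt 2 / 2
  have hpa : 0 ≤ radiusPoly κ a := by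
    have : radiusPoly κ a = (1 + κ) * (a - 1 / 2) := by
      have h3 : a ^ 3 = a / 2 := by rw [pow_succ, ha2]; ring
      rw [radiusPoly, h3, ha2]; ring
    rw [this]
    exact mul_nonneg (by linarith) (by linarith)
  by_contra! hs
  -- Second divided difference at a, s₁, s; its last factor is positive because 4(s + s₁ + a) > 6
  -- while 1 - κ ≤ 1.
  have key : radiusPoly κ s₁ * (s - a) = radiusPoly κ a * (s - s₁) + radiusPoly κ s * (s₁ - a)
      + (s - a) * (s - s₁) * (s₁ - a) * (4 * (s + s₁ + a) - (1 - κ)) := by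
    simp only [radiusPoly]; ring
  have h1 : radiusPoly κ s₁ * (s - a) < 0 := mul_neg_of_neg_of_pos hneg (by linarith)
  have h2 : 0 ≤ radiusPoly κ a * (s - s₁) := mul_nonneg hpa (by linarith)
  have h3 : 0 ≤ radiusPoly κ s * (s₁ - a) := mul_nonneg hs (by linarith)
  have h4 : 0 ≤ (s - a) * (s - s₁) * (s₁ - a) * (4 * (s + s₁ + a) - (1 - κ)) :=
    mul_nonneg (mul_nonneg (mul_nonneg (by linarith) (by linarith)) (by linarith)) (by linarith)
  linarith

/-- The set whose infimum is `ρ̄`. -/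
def radiusSet (κ : ℝ) : Set ℝ := {s | s ∈ Set.Ioo (Real.sqrt 2 / 2) 1 ∧ radiusPoly κ s < 0}

theorem radiusSet_nonempty (κ : ℝ) : (radiusSet κ).Nonempty := by
  have hcont : Tendsto (radiusPoly κ) (𝓝[<] 1) (𝓝 (radiusPoly κ 1)) := by
    refine Tendsto.mono_left ?_ nhdsWithin_le_nhds
    exact Continuous.tendsto (by unfold radiusPoly; fun_prop) 1
  have h1 : radiusPoly κ 1 < 0 := by
    have : radiusPoly κ 1 = -1 := by rw [radiusPoly]; ring
    rw [this]; norm_num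
  have hlt : Real.sqrt 2 / 2 < 1 := by nlinarith [sq_sqrt_two_div_two]
  obtain ⟨s, hs, hs'⟩ := ((hcont.eventually_lt_const h1).and (Ioo_mem_nhdsLT hlt)).exists
  exact ⟨s, hs', hs⟩

theorem radiusSet_bddBelow (κ : ℝ) : BddBelow (radiusSet κ) :=
  ⟨Real.sqrt 2 / 2, fun _ hs => hs.1.1.le⟩

theorem sqrt_two_div_two_le_sInf_radiusSet (κ : ℝ) :
    Real.sqrt 2 / 2 ≤ sInf (radiusSet κ) :=
  le_csInf (radiusSet_nonempty κ) fun _ hs => hs.1.1.le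

theorem sInf_radiusSet_lt_one (κ : ℝ) : sInf (radiusSet κ) < 1 := by
  obtain ⟨s, hs⟩ := radiusSet_nonempty κ
  exact (csInf_le (radiusSet_bddBelow κ) hs).trans_lt hs.1.2

theorem two_mul_sq_sub_one_pos {κ s : ℝ} (hs : sInf (radiusSet κ) < s) :
    0 < 2 * s ^ 2 - 1 := by
  have h1 := (sqrt_two_div_two_le_sInf_radiusSet κ).trans_lt hs
  have h2 := pow_lt_pow_left₀ h1 (by positivity) two_ne_zero
  rw [sq_sqrt_two_div_two] at h2
  linarith

/-- Above `ρ̄` the iteration is a contraction. -/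
theorem one_sub_lt_of_sInf_radiusSet_lt {κ s : ℝ} (hκ : 1 ≤ κ) (hs : sInf (radiusSet κ) < s)
    (hs1 : s ≤ 1) : 1 - s < 2 * s ^ 2 - 1 := by
  have hκ0 : 0 ≤ κ := by linarith
  -- The value s = 1 lies outside the defining interval but occurs when γ = 0.
  rcases hs1.eq_or_lt with rfl | hs1
  · norm_num
  obtain ⟨s₁, h₁, hlt⟩ := exists_lt_of_csInf_lt (radiusSet_nonempty κ) hs
  have hneg := radiusPoly_neg_of_lt hκ0 h₁.1.1 hlt h₁.2
  have hpos := two_mul_sq_sub_one_pos hs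
  have hs0 : 0 < s := by linarith [h₁.1.1, half_lt_sqrt_two_div_two]
  have h := mul_neg_of_pos_of_neg hs0 hneg
  rw [mul_radiusPoly] at h
  -- Negativity reads (1 - s)(1 + (κ-1)s²) < d² with d = 2s² - 1; bound the left side below by 1 - s
  -- and d² above by d.
  have h1 : (1 - s) * 1 ≤ (1 - s) * (1 + (κ - 1) * s ^ 2) := by
    refine mul_le_mul_of_nonneg_left ?_ (by linarith)
    nlinarith [mul_nonneg (sub_nonneg.2 hκ) (sq_nonneg s)]
  have h2 : (2 * s ^ 2 - 1) ^ 2 ≤ 2 * s ^ 2 - 1 := by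
    rw [sq (2 * s ^ 2 - 1)]
    exact mul_le_of_le_one_left hpos.le (by nlinarith)
  linarith

end RadiusPolynomial

/-! ### One step of the method -/

section Iteration

variable {𝕜 : Type*} [RCLike 𝕜]
variable {X : Type*} [NormedAddCommGroup X] [InnerProductSpace 𝕜 X]
variable {Y : Type*} [NormedAddCommGroup Y] [InnerProductSpace 𝕜 Y]

theorem nonneg_of_mem_smaleSet {F : X → Y} {x : X} {β : ℝ} (hβ : 0 ≤ β) {a : ℝ}
    (ha : a ∈ smaleSet 𝕜 F x β) : 0 ≤ a := by
  obtain ⟨n, -, rfl⟩ := ha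
  positivity

theorem smaleBound_sSup {F : X → Y} {x : X} {β : ℝ} (hβ : 0 ≤ β)
    (h : BddAbove (smaleSet 𝕜 F x β)) :
    SmaleBound (taylorSeries 𝕜 F x) β (sSup (smaleSet 𝕜 F x β)) := by
  intro n
  have hn : ((n + 2 : ℕ) : ℝ) - 1 = ((n + 1 : ℕ) : ℝ) := by push_cast; ring
  have hle := le_csSup h ⟨n + 2, by omega, rfl⟩
  rw [← norm_taylorSeries, hn, one_div] at hle
  have h0 : 0 ≤ β * ‖taylorSeries 𝕜 F x (n + 2)‖ := by positivity
  calc β * ‖taylorSeries 𝕜 F x (n + 2)‖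
      = ((β * ‖taylorSeries 𝕜 F x (n + 2)‖) ^ (((n + 1 : ℕ) : ℝ)⁻¹)) ^ (n + 1) :=
        (Real.rpow_inv_natCast_pow h0 n.succ_ne_zero).symm
    _ ≤ _ := by gcongr

theorem prox_spec {J : X → EReal} {H : X →L[𝕜] X} {z : X} (h : ∃ p, IsProxPoint J H z p) :
    IsProxPoint J H z (prox J H z) := by
  rw [prox, dif_pos h]
  exact h.choose_spec

variable [CompleteSpace X] [CompleteSpace Y]

/-- One step of the method from a point of the ball of convergence. -/
theorem stepWellDefined_and_norm_prox_sub_le {Ω : Set X} (hΩ : IsOpen Ω) {J : X → EReal}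
    (hJp : IsProper J) (hJc : IsConvex 𝕜 J) (hJl : LowerSemicontinuousOn J Ω)
    {F : X → Y} {xs : X} (hF0 : F xs = 0) (hfin : J xs ≠ ⊤) (hmin : ∀ y, J xs ≤ J y)
    {β γ r : ℝ} (hβ : 0 < β) (hγ : 0 ≤ γ) (hγr : γ * r < 1)
    (hball : Metric.ball xs r ⊆ Ω) (hinv : ∀ u, ‖u‖ ≤ β * ‖fderiv 𝕜 F xs u‖)
    {p : FormalMultilinearSeries 𝕜 X Y} (hsm : SmaleBound p β γ)
    (hF : HasFPowerSeriesOnBall F p xs (ENNReal.ofReal r))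
    {x : X} (hx : ‖x - xs‖ < r)
    (hcontr : γ * ‖x - xs‖ < 2 * (1 - γ * ‖x - xs‖) ^ 2 - 1) :
    StepWellDefined 𝕜 Ω F J x ∧
      (2 * (1 - γ * ‖x - xs‖) ^ 2 - 1) *
        ‖prox J (normalOp 𝕜 F x) (gaussNewtonPoint 𝕜 F x) - xs‖ ≤ γ * ‖x - xs‖ ^ 2 := by
  have hlip := hsm.norm_fderiv_sub_le hβ hγ hγr hF hx
  have herr := hsm.norm_linearization_error_le hβ hγ hγr hF hF0 hx
  rw [add_sub_cancel] at hlip herr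
  set T := fderiv 𝕜 F x with hTdef
  set t := ‖x - xs‖ with ht
  have ht0 : 0 ≤ t := norm_nonneg _
  have hγt : 0 ≤ γ * t := by positivity
  set s := 1 - γ * t with hs
  have hs0 : 0 < s := by
    have : γ * t ≤ γ * r := by gcongr
    linarith
  set d := 2 * s ^ 2 - 1 with hd
  have hd0 : 0 < d := hγt.trans_lt hcontr
  -- Perturbation of ‖u‖ ≤ β‖F'(x_*)u‖: the error (1/s² - 1)‖u‖ is absorbed on the left after
  -- multiplying by s².
  have hTlow : ∀ u, d * ‖u‖ ≤ s ^ 2 * (β * ‖T u‖) := by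
    intro u
    have h1 : ‖fderiv 𝕜 F xs u‖ ≤ ‖T u‖ + ‖T - fderiv 𝕜 F xs‖ * ‖u‖ := by
      have e : fderiv 𝕜 F xs u = T u - (T - fderiv 𝕜 F xs) u := by simp
      rw [e]
      exact (norm_sub_le _ _).trans (by gcongr; exact ContinuousLinearMap.le_opNorm _ _)
    have h2 : ‖u‖ ≤ β * ‖T u‖ + (1 / s ^ 2 - 1) * ‖u‖ := by
      calc ‖u‖ ≤ β * ‖fderiv 𝕜 F xs u‖ := hinv u
        _ ≤ β * (‖T u‖ + ‖T - fderiv 𝕜 F xs‖ * ‖u‖) := by gcongr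
        _ = β * ‖T u‖ + β * ‖T - fderiv 𝕜 F xs‖ * ‖u‖ := by ring
        _ ≤ _ := by gcongr
    have h3 := mul_le_mul_of_nonneg_left h2 (sq_nonneg s)
    have h4 : s ^ 2 * (β * ‖T u‖ + (1 / s ^ 2 - 1) * ‖u‖)
        = s ^ 2 * (β * ‖T u‖) + (1 - s ^ 2) * ‖u‖ := by field_simp
    rw [h4] at h3
    rw [hd]
    linarith
  have hc : 0 < d / (s ^ 2 * β) := by positivity
  have hTc : ∀ u, d / (s ^ 2 * β) * ‖u‖ ≤ ‖T u‖ := by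
    intro u
    rw [div_mul_eq_mul_div, div_le_iff₀ (by positivity)]
    linarith [hTlow u]
  have hunit := isUnit_adjoint_comp_self hc hTc
  have hpinv := exists_isMoorePenroseInverse hunit
  have hz : ‖T (gaussNewtonPoint 𝕜 F x - xs)‖ ≤ ‖T (x - xs) - F x‖ := by
    have e : gaussNewtonPoint 𝕜 F x - xs = (x - xs) - pinv T (F x) := by
      rw [gaussNewtonPoint]; abel
    rw [e]
    exact norm_map_pinv_sub_le hpinv _ _
  have hbound : ∀ q, ‖T (q - xs)‖ ≤ ‖T (gaussNewtonPoint 𝕜 F x - xs)‖ →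
      d * ‖q - xs‖ ≤ γ * t ^ 2 := by
    intro q hq
    calc d * ‖q - xs‖ ≤ s ^ 2 * (β * ‖T (q - xs)‖) := hTlow _
      _ ≤ s ^ 2 * (β * ‖T (x - xs) - F x‖) := by gcongr; exact hq.trans hz
      _ ≤ s ^ 2 * (γ * t ^ 2 / s ^ 2) := by gcongr
      _ = γ * t ^ 2 := by field_simp
  -- Since γt < d, every candidate allowed by nonexpansiveness stays within distance t of x_*, hence
  -- in Ω, where J is semicontinuous.
  have hsub : ∀ q, ‖T (q - xs)‖ ≤ ‖T (gaussNewtonPoint 𝕜 F x - xs)‖ → q ∈ Ω := by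
    intro q hq
    refine hball (mem_ball_iff_norm.2 (lt_of_le_of_lt ?_ hx))
    refine le_of_mul_le_mul_left ((hbound q hq).trans ?_) hd0
    calc γ * t ^ 2 = γ * t * t := by ring
      _ ≤ d * t := by gcongr
  obtain ⟨q, hq, huniq, hqle⟩ :=
    existsUnique_isProxPoint hΩ hJp hJc hJl hfin hmin hc hTc hsub
  refine ⟨⟨hball (mem_ball_iff_norm.2 hx), ?_, hunit, q, hq, huniq⟩, ?_⟩
  · obtain ⟨B, hB⟩ := hpinv
    exact ⟨B, hB, fun C hC => hC.unique hB⟩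
  · have : prox J (normalOp 𝕜 F x) (gaussNewtonPoint 𝕜 F x) = q := huniq _ (prox_spec ⟨q, hq⟩)
    rw [this]
    exact hbound q hqle

end Iteration

/-- A point of the open ball of supremal radius already lies in a ball of some admissible radius;
the cap R keeps the supremum finite. -/
theorem pos_sSup_and_ball_subset {X : Type*} [PseudoMetricSpace X] {Ω : Set X} (hΩ : IsOpen Ω)
    {x : X} (hx : x ∈ Ω) {R : ℝ} (hR : 0 < R) :
    0 < sSup {t : ℝ | t ∈ Set.Ico 0 R ∧ Metric.ball x t ⊆ Ω} ∧
      Metric.ball x (sSup {t : ℝ | t ∈ Set.Ico 0 R ∧ Metric.ball x t ⊆ Ω}) ⊆ Ω := by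
  set S := {t : ℝ | t ∈ Set.Ico 0 R ∧ Metric.ball x t ⊆ Ω}
  have hbdd : BddAbove S := ⟨R, fun t ht => ht.1.2.le⟩
  obtain ⟨ε, hε, hball⟩ := Metric.isOpen_iff.1 hΩ x hx
  have hmem : min ε (R / 2) ∈ S :=
    ⟨⟨by positivity, (min_le_right _ _).trans_lt (by linarith)⟩,
      (Metric.ball_subset_ball (min_le_left _ _)).trans hball⟩
  refine ⟨lt_of_lt_of_le (by positivity) (le_csSup hbdd hmem), fun y hy => ?_⟩
  obtain ⟨t, ht, hlt⟩ := exists_lt_of_lt_csSup ⟨_, hmem⟩ (Metric.mem_ball.1 hy)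
  exact ht.2 (Metric.mem_ball.2 hlt)

end ProxGaussNewton

/-! ### Convergence of the proximal Gauss-Newton sequence -/

theorem corollary4p7
    {𝕜 : Type*} [RCLike 𝕜]
    {X : Type*} [NormedAddCommGroup X] [InnerProductSpace 𝕜 X] [CompleteSpace X]
    {Y : Type*} [NormedAddCommGroup Y] [InnerProductSpace 𝕜 Y] [CompleteSpace Y]
    (Ω : Set X) (hΩ : IsOpen Ω)
    -- the penalty: proper, convex, lower semicontinuous at the points of `Ω`
    (J : X → EReal) (hJp : ProxGaussNewton.IsProper J) (hJc : ProxGaussNewton.IsConvex 𝕜 J)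
    (hJl : LowerSemicontinuousOn J Ω)
    -- the analytic map `F : Ω → Y`, whose derivatives have closed images
    (F : X → Y) (hF : AnalyticOnNhd 𝕜 F Ω)
    (hFc : ∀ x ∈ Ω, IsClosed (Set.range (fderiv 𝕜 F x)))
    (xs : X) (hxs : xs ∈ Ω) (R : ℝ) (hR : 0 < R)
    (β κ δ γ ρ r : ℝ)
    (hβ : β = ‖ProxGaussNewton.pinv (fderiv 𝕜 F xs)‖)
    (hκ : κ = β * ‖fderiv 𝕜 F xs‖)
    (hδ : δ = sSup {t : ℝ | t ∈ Set.Ico 0 R ∧ Metric.ball xs t ⊆ Ω})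
    (hF0 : F xs = 0)
    (hJ0 : (0 : X) ∈ ProxGaussNewton.subdifferential 𝕜 J xs)
    (hinj : Function.Injective (fderiv 𝕜 F xs))
    (hγfin : BddAbove (ProxGaussNewton.smaleSet 𝕜 F xs β))
    (hγ : γ = sSup (ProxGaussNewton.smaleSet 𝕜 F xs β))
    (hρ : ρ = sInf {s : ℝ | s ∈ Set.Ioo (Real.sqrt 2 / 2) 1 ∧
      -4 * s ^ 3 + (1 - κ) * s ^ 2 + (3 + κ) * s - 1 < 0})
    -- `(1 - ρ) / γ` is read as `+∞` if `γ = 0`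
    (hr : r = if γ = 0 then δ else min ((1 - ρ) / γ) δ) :
    0 < ρ ∧ 0 < r ∧
    ∀ x₀ ∈ Metric.ball xs r \ {xs}, ∀ x : ℕ → X,
      x = ProxGaussNewton.proxGaussNewtonSeq 𝕜 F J x₀ →
        (∀ k, ProxGaussNewton.StepWellDefined 𝕜 Ω F J (x k)) ∧
        (∀ k, x k ∈ Metric.ball xs r) ∧
        Filter.Tendsto x Filter.atTop (nhds xs) ∧
        ∀ k, ‖x (k + 1) - xs‖ ≤
          γ * (1 + (κ - 1) * (1 - γ * ‖x₀ - xs‖) ^ 2) /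
            (1 - 2 * (1 - γ * ‖x₀ - xs‖) ^ 2) ^ 2 * ‖x k - xs‖ ^ 2 := by
  have hβ0 : 0 ≤ β := hβ ▸ norm_nonneg _
  have hγ0 : 0 ≤ γ := hγ ▸ Real.sSup_nonneg fun a ha =>
    ProxGaussNewton.nonneg_of_mem_smaleSet hβ0 ha
  change ρ = sInf (ProxGaussNewton.radiusSet κ) at hρ
  have hρ0 : 0 < ρ := by
    have h1 := ProxGaussNewton.sqrt_two_div_two_le_sInf_radiusSet κ
    have h2 := ProxGaussNewton.half_lt_sqrt_two_div_two
    linarith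
  have hρ1 : ρ < 1 := hρ ▸ ProxGaussNewton.sInf_radiusSet_lt_one κ
  obtain ⟨hδ0, hδball⟩ := ProxGaussNewton.pos_sSup_and_ball_subset hΩ hxs hR
  rw [← hδ] at hδ0 hδball
  have hr0 : 0 < r ∧ r ≤ δ ∧ γ * r ≤ 1 - ρ := by
    rw [hr]
    split_ifs with h0
    · exact ⟨hδ0, le_rfl, by rw [h0]; linarith⟩
    · have hγpos : 0 < γ := lt_of_le_of_ne hγ0 (Ne.symm h0)
      refine ⟨lt_min (div_pos (by linarith) hγpos) hδ0, min_le_right _ _, ?_⟩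
      rw [mul_comm, ← le_div_iff₀ hγpos]
      exact min_le_left _ _
  obtain ⟨hr0, hrδ, hγr⟩ := hr0
  refine ⟨hρ0, hr0, ?_⟩
  rintro x₀ ⟨hx₀, hne⟩ x rfl
  have hpos : 0 < ‖x₀ - xs‖ := norm_pos_iff.2 (sub_ne_zero.2 hne)
  have hx₀r : ‖x₀ - xs‖ < r := mem_ball_iff_norm.1 hx₀
  have hballΩ : Metric.ball xs r ⊆ Ω := (Metric.ball_subset_ball hrδ).trans hδball
  have hinv : ∀ u, ‖u‖ ≤ β * ‖fderiv 𝕜 F xs u‖ := by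
    intro u
    have hB := ProxGaussNewton.pinv_spec
      (ProxGaussNewton.exists_isMoorePenroseInverse_of_isClosed_range hinj (hFc xs hxs))
    have h := (ProxGaussNewton.pinv (fderiv 𝕜 F xs)).le_opNorm (fderiv 𝕜 F xs u)
    rwa [hB.apply_apply_of_injective hinj, ← hβ] at h
  -- The point x₀ ≠ x_* shows that X is nontrivial, which forces β > 0 and κ ≥ 1.
  have hβpos : 0 < β := by
    refine lt_of_le_of_ne hβ0 fun h => ?_
    have := hinv (x₀ - xs)
    rw [← h, zero_mul] at this
    linarith
  have hκ1 : 1 ≤ κ := by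
    have h1 := (hinv (x₀ - xs)).trans
      (mul_le_mul_of_nonneg_left ((fderiv 𝕜 F xs).le_opNorm (x₀ - xs)) hβ0)
    rw [← mul_assoc, ← hκ] at h1
    exact le_of_mul_le_mul_right (by rwa [one_mul]) hpos
  have hsm := ProxGaussNewton.smaleBound_sSup hβ0 hγfin
  rw [← hγ] at hsm
  have hγr1 : γ * r < 1 := by linarith
  have hps := hsm.hasFPowerSeriesOnBall hβpos hγ0 hr0 hγr1 (hF.mono hballΩ)
  have hmin : ∀ y, J xs ≤ J y := by
    intro y
    simpa using hJ0.2 y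
  have hstep := fun (y : X) => ProxGaussNewton.stepWellDefined_and_norm_prox_sub_le hΩ hJp hJc hJl
    hF0 hJ0.1 hmin hβpos hγ0 hγr1 hballΩ hinv hsm hps (x := y)
  set t₀ := ‖x₀ - xs‖ with ht₀
  have hγt₀ : 0 ≤ γ * t₀ := by positivity
  have hs_gt : sInf (ProxGaussNewton.radiusSet κ) < 1 - γ * t₀ := by
    rw [← hρ]
    rcases hγ0.eq_or_lt with h | h
    · rw [← h]; linarith
    · have := mul_lt_mul_of_pos_left hx₀r h
      linarith
  have hcontr := ProxGaussNewton.one_sub_lt_of_sInf_radiusSet_lt hκ1 hs_gt (by linarith)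
  set s := 1 - γ * t₀ with hs
  have hs0 : 0 < s := by rw [← hρ] at hs_gt; linarith
  set d := 2 * s ^ 2 - 1 with hd
  have hγt₀d : γ * t₀ < d := by linarith
  have hd0 : 0 < d := hγt₀.trans_lt hγt₀d
  have hd1 : d ≤ 1 := by nlinarith
  -- The factor d is frozen at the initial distance t₀: closer points only have a larger factor.
  have hmono : ∀ y : X, ‖y - xs‖ ≤ t₀ → d ≤ 2 * (1 - γ * ‖y - xs‖) ^ 2 - 1 := by
    intro y hy
    have h1 : s ≤ 1 - γ * ‖y - xs‖ := by
      have := mul_le_mul_of_nonneg_left hy hγ0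
      linarith
    have := pow_le_pow_left₀ hs0.le h1 2
    linarith
  have hgood : ∀ y : X, ‖y - xs‖ ≤ t₀ → ProxGaussNewton.StepWellDefined 𝕜 Ω F J y ∧
      d * ‖ProxGaussNewton.prox J (ProxGaussNewton.normalOp 𝕜 F y)
        (ProxGaussNewton.gaussNewtonPoint 𝕜 F y) - xs‖ ≤ γ * ‖y - xs‖ ^ 2 := by
    intro y hy
    have hm := hmono y hy
    have h := hstep y (hy.trans_lt hx₀r)
      (((mul_le_mul_of_nonneg_left hy hγ0).trans_lt hγt₀d).trans_le hm)
    exact ⟨h.1, (mul_le_mul_of_nonneg_right hm (norm_nonneg _)).trans h.2⟩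
  set x := ProxGaussNewton.proxGaussNewtonSeq 𝕜 F J x₀ with hx
  -- One step multiplies the distance by at most γ‖x k - x_*‖/d ≤ q, so the error decays
  -- geometrically and never exceeds t₀.
  set q := γ * t₀ / d with hq
  have hq0 : 0 ≤ q := by positivity
  have hq1 : q < 1 := (div_lt_one hd0).2 hγt₀d
  have hgeom : ∀ k, ‖x k - xs‖ ≤ q ^ k * t₀ := by
    intro k
    induction k with
    | zero => rw [pow_zero, one_mul]; exact le_rfl
    | succ k ih =>
      have hle : ‖x k - xs‖ ≤ t₀ :=
        ih.trans (mul_le_of_le_one_left hpos.le (pow_le_one₀ hq0 hq1.le))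
      have h := (hgood (x k) hle).2
      change d * ‖x (k + 1) - xs‖ ≤ _ at h
      refine le_of_mul_le_mul_left (h.trans ?_) hd0
      calc γ * ‖x k - xs‖ ^ 2 = γ * ‖x k - xs‖ * ‖x k - xs‖ := by ring
        _ ≤ γ * t₀ * (q ^ k * t₀) := by gcongr
        _ = d * (q ^ (k + 1) * t₀) := by rw [pow_succ, hq]; field_simp
  have hle : ∀ k, ‖x k - xs‖ ≤ t₀ := fun k =>
    (hgeom k).trans (mul_le_of_le_one_left hpos.le (pow_le_one₀ hq0 hq1.le))
  refine ⟨fun k => (hgood _ (hle k)).1, fun k => mem_ball_iff_norm.2 ((hle k).trans_lt hx₀r),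
    ?_, fun k => ?_⟩
  · rw [tendsto_iff_norm_sub_tendsto_zero]
    refine squeeze_zero (fun _ => norm_nonneg _) hgeom ?_
    simpa using (tendsto_pow_atTop_nhds_zero_of_lt_one hq0 hq1).mul_const t₀
  · have h := (hgood _ (hle k)).2
    change d * ‖x (k + 1) - xs‖ ≤ _ at h
    -- The proved rate γ/d is sharper than the claimed one: d ≤ 1 ≤ 1 + (κ-1)s².
    have hK : 1 ≤ 1 + (κ - 1) * s ^ 2 :=
      le_add_of_nonneg_right (mul_nonneg (by linarith) (sq_nonneg s))
    have hsq : (1 - 2 * s ^ 2) ^ 2 = d ^ 2 := by rw [hd]; ring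
    rw [hsq, div_mul_eq_mul_div, le_div_iff₀ (by positivity)]
    calc ‖x (k + 1) - xs‖ * d ^ 2 = d * ‖x (k + 1) - xs‖ * d := by ring
      _ ≤ γ * ‖x k - xs‖ ^ 2 * (1 + (κ - 1) * s ^ 2) := by
        gcongr
        exact hd1.trans hK
      _ = γ * (1 + (κ - 1) * s ^ 2) * ‖x k - xs‖ ^ 2 := by ring
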